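/- Terms are variables or constants, and an atom is $p(t_1,\dots,t_k)$ with $p$ a predicate of arity $k$ and terms $t_i$. An existential rule $r=B\to H$ stands for $\forall \vec x\,\forall\vec y\,(B[\vec x,\vec y]\to\exists \vec z\,H[\vec x,\vec z])$, with $B,H$ non-empty finite conjunctions of atoms; $\vec x$ are its frontier variables and $\vec z$ its existential variables. A knowledge base $(\mathcal F,\mathcal R)$ is a finite set $\mathcal F$ of variable-free atoms with a finite set $\mathcal R$ of existential rules. An atomic CQ is the existential closure of a single atom. A transitivity rule is a rule $p(x,y)\wedge p(y,z)\to p(x,z)$. For a rule set $\mathcal R$, take fresh predicates $F_{r,y}$ (unary), $S,D$ (binary), $C$ (nullary) and fresh constants $*$ and $c_{r,y}$, for $r\in\mathcal R$ and $y$ an existential variable of $r$. Let $\mathrm{MSA}(\mathcal R)$ consist of the rules $$B\to\Bigl(H\wedge\bigwedge_{y}\bigl(F_{r,y}(y)\wedge\bigwedge_{x}S(x,y)\bigr)\Bigr)[y\mapsto c_{r,y}]$$ for $r=B\to H$ in $\mathcal R$ ($y$ ranging over its existential and $x$ over its frontier variables), the rules $S(x,y)\to D(x,y)$ and $D(x,y)\wedge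 S(y,z)\to D(x,z)$, and the rules $F_{r,y}(x)\wedge D(x,x')\wedge F_{r,y}(x')\to C$. Let $I^*_{\mathcal R}$ be the set of all facts over the predicates occurring in $\mathcal R$ and the constants occurring in $\mathcal R$ together with $*$. The set $\mathcal R$ is model-summarizing acyclic (msa) if $I^*_{\mathcal R}\cup\mathrm{MSA}(\mathcal R)\not\models C$. A rule set is in msa+trans if it is the union of an msa rule set and a set of transitivity rules. **Proposition.** Atomic CQ entailment over msa+trans knowledge bases is undecidable: no algorithm, given a knowledge base $(\mathcal F,\mathcal R)$ with $\mathcal R$ in msa+trans and an atomic CQ $Q$, always halts and correctly answers whether $(\mathcal F,\mathcal R)\models Q$. -/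

import Mathlib

namespace ExRules

/-- Terms over a set `K` of constants: a constant `Sum.inl c` or a variable `Sum.inr x`. -/
abbrev Term (K : Type) : Type := K ⊕ ℕ

/-- An atom `p(t₁, …, t_k)`: a predicate name and the list of its arguments. A predicate is a name
together with an arity, so the same name with lists of different lengths denotes different
predicates; there are infinitely many predicates of each arity as soon as `P` is infinite. -/
abbrev Atom (P K : Type) : Type := P × List (Term K)

/-- An existential rule `B → H`, as the pair of its body `B` and its head `H`, both finite
conjunctions of atoms. Variables are implicitly quantified, see `Interp.SatRule`. -/
abbrev Rule (P K : Type) : Type := List (Atom P K) × List (Atom P K)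

variable {P K : Type}

/-- The variable `x` occurs in the conjunction `A`. -/
def VarIn (x : ℕ) (A : List (Atom P K)) : Prop := ∃ a ∈ A, Sum.inr x ∈ a.2

/-- The constant `c` occurs in the conjunction `A`. -/
def ConstIn (c : K) (A : List (Atom P K)) : Prop := ∃ a ∈ A, Sum.inl c ∈ a.2

/-- Frontier variables occur in the body and in the head. -/
def IsFrontier (r : Rule P K) (x : ℕ) : Prop := VarIn x r.1 ∧ VarIn x r.2

/-- Existential variables occur in the head only. -/
def IsExistential (r : Rule P K) (x : ℕ) : Prop := ¬ VarIn x r.1 ∧ VarIn x r.2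

/-- A fact is an atom without variables. -/
def IsFact (a : Atom P K) : Prop := ∀ x : ℕ, Sum.inr x ∉ a.2

/-! ### First-order semantics -/

/-- A first-order interpretation with domain `D` (non-empty whenever `K` is). -/
structure Interp (P K D : Type) where
  const : K → D
  rel : P → List D → Prop

namespace Interp

variable {D : Type} (I : Interp P K D)

/-- The value of a term under a variable assignment. -/
def val (v : ℕ → D) : Term K → D
  | Sum.inl c => I.const c
  | Sum.inr x => v x

def SatAtom (v : ℕ → D) (a : Atom P K) : Prop := I.rel a.1 (a.2.map (I.val v))

def SatConj (v : ℕ → D) (A : List (Atom P K)) : Prop := ∀ a ∈ A, I.SatAtom v a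

/-- `I ⊨ ∀ x y, (B[x, y] → ∃ z, H[x, z])`. -/
def SatRule (r : Rule P K) : Prop :=
  ∀ v : ℕ → D, I.SatConj v r.1 →
    ∃ w : ℕ → D, (∀ x, VarIn x r.1 → w x = v x) ∧ I.SatConj w r.2

/-- `I ⊨ Q` for a Boolean conjunctive query `Q`, the existential closure of a conjunction. -/
def SatCQ (Q : List (Atom P K)) : Prop := ∃ v : ℕ → D, I.SatConj v Q

end Interp

/-- Logical entailment `(F, R) ⊨ Q` of a Boolean conjunctive query: `Q` holds in every model of
the facts `F` and the rules `R`. (A fact has no variables, so it is the same as the conjunctive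
query that consists of it.) -/
def Entails (F : Set (Atom P K)) (R : Set (Rule P K)) (Q : List (Atom P K)) : Prop :=
  ∀ (D : Type) (I : Interp P K D),
    (∀ a ∈ F, I.SatCQ [a]) → (∀ r ∈ R, I.SatRule r) → I.SatCQ Q

/-! ### Model-summarizing acyclicity -/

/-- Predicates of the summarizing program: those of the rule set, a unary predicate `F_{r,y}` for
each rule `r` and existential variable `y` of `r`, binary predicates `S` and `D`, and a nullary
predicate `C`. -/
inductive MSAPred (P K : Type) : Type
  | orig (p : P)
  | F (r : Rule P K) (y : ℕ)
  | S
  | D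
  | C

/-- Constants of the summarizing program: those of the rule set, the constant `∗` of the critical
instance, and a constant `c_{r,y}` for each rule `r` and existential variable `y` of `r`. -/
inductive MSAConst (P K : Type) : Type
  | orig (c : K)
  | star
  | sk (r : Rule P K) (y : ℕ)

/-- The embedding of terms over `K`, which keeps the variables. -/
def liftTerm : Term K → Term (MSAConst P K)
  | Sum.inl c => Sum.inl (MSAConst.orig c)
  | Sum.inr x => Sum.inr x

open Classical in
/-- The embedding of the terms of `r`, with each variable `y` that is not in the body replaced by
the constant `c_{r,y}`. -/
noncomputable def skTerm (r : Rule P K) : Term K → Term (MSAConst P K)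
  | Sum.inl c => Sum.inl (MSAConst.orig c)
  | Sum.inr x => if VarIn x r.1 then Sum.inr x else Sum.inl (MSAConst.sk r x)

/-- The body of `r`, embedded into the vocabulary of the summarizing program. -/
def msaBody (r : Rule P K) : List (Atom (MSAPred P K) (MSAConst P K)) :=
  r.1.map fun a => (MSAPred.orig a.1, a.2.map liftTerm)

/-- The rule `B → H` with `c_{r,y}` substituted for each existential variable `y`. -/
noncomputable def msaMain (r : Rule P K) : Rule (MSAPred P K) (MSAConst P K) :=
  (msaBody r, r.2.map fun a => (MSAPred.orig a.1, a.2.map (skTerm r)))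

/-- The summarizing program of a rule set. The rule
`B → H ∧ ⋀_y (F_{r,y}(y) ∧ ⋀_x S(x, y))`, where `y` ranges over the existential and `x` over the
frontier variables of `r` and `c_{r,y}` is substituted for each `y`, is given here by one rule
with body `B` for each part of the head. -/
inductive MSAProgram (R : Set (Rule P K)) : Rule (MSAPred P K) (MSAConst P K) → Prop
  | main (r : Rule P K) (hr : r ∈ R) : MSAProgram R (msaMain r)
  | mark (r : Rule P K) (hr : r ∈ R) (y : ℕ) (hy : IsExistential r y) :
      MSAProgram R (msaBody r, [(MSAPred.F r y, [Sum.inl (MSAConst.sk r y)])])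
  | succ (r : Rule P K) (hr : r ∈ R) (y : ℕ) (hy : IsExistential r y)
      (x : ℕ) (hx : IsFrontier r x) :
      MSAProgram R (msaBody r, [(MSAPred.S, [Sum.inr x, Sum.inl (MSAConst.sk r y)])])
  -- `S(x, y) → D(x, y)`
  | base : MSAProgram R
      ([(MSAPred.S, [Sum.inr 0, Sum.inr 1])], [(MSAPred.D, [Sum.inr 0, Sum.inr 1])])
  -- `D(x, y) ∧ S(y, z) → D(x, z)`
  | step : MSAProgram R
      ([(MSAPred.D, [Sum.inr 0, Sum.inr 1]), (MSAPred.S, [Sum.inr 1, Sum.inr 2])],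
        [(MSAPred.D, [Sum.inr 0, Sum.inr 2])])
  -- `F_{r,y}(x) ∧ D(x, x') ∧ F_{r,y}(x') → C`
  | cycle (r : Rule P K) (hr : r ∈ R) (y : ℕ) (hy : IsExistential r y) : MSAProgram R
      ([(MSAPred.F r y, [Sum.inr 0]), (MSAPred.D, [Sum.inr 0, Sum.inr 1]),
        (MSAPred.F r y, [Sum.inr 1])], [(MSAPred.C, [])])

/-- The constants of the critical instance: `∗` and the constants that occur in `R`. -/
inductive CritConst (R : Set (Rule P K)) : MSAConst P K → Prop
  | star : CritConst R MSAConst.star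
  | orig (c : K) (r : Rule P K) (hr : r ∈ R) (hc : ConstIn c (r.1 ++ r.2)) :
      CritConst R (MSAConst.orig c)

/-- The critical instance of `R`: all facts over the predicates that occur in `R` (with the arity
with which they occur) and the constants `CritConst R`. -/
def criticalInstance (R : Set (Rule P K)) : Set (Atom (MSAPred P K) (MSAConst P K)) :=
  {a | ∃ r ∈ R, ∃ b ∈ r.1 ++ r.2, a.1 = MSAPred.orig b.1 ∧ a.2.length = b.2.length ∧
    ∀ t ∈ a.2, ∃ c, CritConst R c ∧ t = Sum.inl c}

/-- `R` is model-summarizing acyclic: the summarizing program does not derive `C` from the critical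
instance. -/
def IsMSA (R : Set (Rule P K)) : Prop :=
  ¬ Entails (criticalInstance R) {ρ | MSAProgram R ρ} [(MSAPred.C, [])]

/-! ### The decision problem -/

/-- `p(x, y) ∧ p(y, z) → p(x, z)` with distinct variables `x`, `y`, `z`. -/
def IsTransitivityRule (r : Rule P K) : Prop :=
  ∃ (p : P) (x y z : ℕ), x ≠ y ∧ x ≠ z ∧ y ≠ z ∧
    r = ([(p, [Sum.inr x, Sum.inr y]), (p, [Sum.inr y, Sum.inr z])], [(p, [Sum.inr x, Sum.inr z])])

/-- `R` belongs to the class msa+trans: it is the union of an msa set and a set of transitivity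
rules. -/
def IsMSAPlusTrans (R : Set (Rule P K)) : Prop :=
  ∃ R₀ T : Set (Rule P K), R = R₀ ∪ T ∧ IsMSA R₀ ∧ ∀ r ∈ T, IsTransitivityRule r

/-- An instance of atomic query entailment: a finite fact base, a finite rule set, and an atomic
query. Predicate names and constants are natural numbers. -/
abbrev Instance : Type := List (Atom ℕ ℕ) × List (Rule ℕ ℕ) × Atom ℕ ℕ

/-- The instance is over an msa+trans knowledge base: its fact base consists of facts, its rules
have non-empty bodies and heads, and its rule set is in msa+trans. -/
def Instance.OverMSAPlusTrans (i : Instance) : Prop :=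
  (∀ a ∈ i.1, IsFact a) ∧ (∀ r ∈ i.2.1, r.1 ≠ [] ∧ r.2 ≠ []) ∧ IsMSAPlusTrans {r | r ∈ i.2.1}

/-- The knowledge base of the instance entails its query. -/
def Instance.Entailed (i : Instance) : Prop :=
  Entails {a | a ∈ i.1} {r | r ∈ i.2.1} [i.2.2]

/-- The problem `p`, restricted to the inputs that satisfy `dom`, is decidable: some algorithm
halts with the correct answer on each of these inputs (and may do anything on other inputs). -/
def DecidableOn {α : Type} [Primcodable α] (dom p : α → Prop) : Prop :=
  ∃ f : α →. Bool, Partrec f ∧ ∀ a, dom a → ∃ b ∈ f a, (b = true ↔ p a)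

end ExRules

/-!
The halting problem of a partial recursive code reduces to the entailment problem. The rule
`next(x, y) ∧ t(y, x) → ∃ z u, next(y, z) ∧ t(z, u) ∧ t(u, y)` derives `t(z, y)` from its head only
if `t` is transitive. With transitivity it therefore prolongs a `next`-chain of constants forever,
and Datalog rules can compute on this infinite copy of the natural numbers. Without transitivity
it cannot fire on the elements it creates, hence it is model-summarizing acyclic, and Datalog rules
add no cycle.
-/

namespace ExRules

open Nat.Partrec (Code)
open Nat.Partrec.Code (eval exists_code eval_prec_zero eval_prec_succ)
open Encodable (encode)
open Denumerable (ofNat)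

/-! ### Datalog rules -/

section Semantics

variable {P K D : Type} (I : Interp P K D)

/-- The atom whose predicate is `p` and whose arguments are the variables `xs`. -/
def varAtom (p : P) (xs : List ℕ) : Atom P K := (p, xs.map Sum.inr)

/-- The fact whose predicate is `p` and whose arguments are the constants `cs`. -/
def constAtom (p : P) (cs : List K) : Atom P K := (p, cs.map Sum.inl)

/-- A rule all of whose head variables occur in the body. -/
def IsDatalog (r : Rule P K) : Prop := ∀ x, VarIn x r.2 → VarIn x r.1

@[simp]
theorem varAtom_fst (p : P) (xs : List ℕ) : (varAtom p xs : Atom P K).1 = p := rfl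

@[simp]
theorem inr_mem_varAtom (p : P) (xs : List ℕ) (x : ℕ) :
    (Sum.inr x : Term K) ∈ (varAtom p xs : Atom P K).2 ↔ x ∈ xs := by
  simp [varAtom]

theorem isFact_constAtom (p : P) (cs : List K) : IsFact (constAtom p cs) := by
  simp [IsFact, constAtom]

@[simp]
theorem not_varIn_nil (x : ℕ) : ¬ VarIn x ([] : List (Atom P K)) := by
  simp [VarIn]

@[simp]
theorem varIn_cons (x : ℕ) (a : Atom P K) (A : List (Atom P K)) :
    VarIn x (a :: A) ↔ Sum.inr x ∈ a.2 ∨ VarIn x A := by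
  simp [VarIn]

namespace Interp

@[simp]
theorem satAtom_varAtom (v : ℕ → D) (p : P) (xs : List ℕ) :
    I.SatAtom v (varAtom p xs) ↔ I.rel p (xs.map v) := by
  simp [SatAtom, varAtom, Function.comp_def, val]

@[simp]
theorem satConj_nil (v : ℕ → D) : I.SatConj v [] := by
  simp [SatConj]

@[simp]
theorem satConj_cons (v : ℕ → D) (a : Atom P K) (A : List (Atom P K)) :
    I.SatConj v (a :: A) ↔ I.SatAtom v a ∧ I.SatConj v A := by
  simp [SatConj]

theorem satCQ_constAtom [Nonempty D] (p : P) (cs : List K) :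
    I.SatCQ [constAtom p cs] ↔ I.rel p (cs.map I.const) := by
  simp [SatCQ, SatAtom, constAtom, Function.comp_def, val]

theorem satConj_congr {v w : ℕ → D} {A : List (Atom P K)} (h : ∀ x, VarIn x A → w x = v x) :
    I.SatConj w A ↔ I.SatConj v A := by
  refine forall₂_congr fun a ha => ?_
  have args_eq : a.2.map (I.val w) = a.2.map (I.val v) := by
    refine List.map_congr_left fun t ht => ?_
    cases t with
    | inl c => rfl
    | inr x => exact h x ⟨a, ha, ht⟩
  rw [SatAtom, SatAtom, args_eq]

theorem satRule_iff_of_isDatalog {r : Rule P K} (hr : IsDatalog r) :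
    I.SatRule r ↔ ∀ v, I.SatConj v r.1 → I.SatConj v r.2 := by
  refine forall₂_congr fun v _ => ⟨?_, fun h => ⟨v, fun _ _ => rfl, h⟩⟩
  rintro ⟨w, hw, h⟩
  exact (I.satConj_congr fun x hx => hw x (hr x hx)).1 h

theorem forall_satRule_iff_of_isDatalog {L : List (Rule P K)} (hL : ∀ r ∈ L, IsDatalog r) :
    (∀ r ∈ L, I.SatRule r) ↔ ∀ r ∈ L, ∀ v, I.SatConj v r.1 → I.SatConj v r.2 :=
  forall₂_congr fun r hr => I.satRule_iff_of_isDatalog (hL r hr)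

end Interp

end Semantics

/-! ### A criterion for model-summarizing acyclicity -/

section Acyclicity

variable {P K D : Type}

/-- An interpretation of the summarizing program whose domain has two layers: the elements of `X`,
from which all `S`- and `D`-edges start, and the others, which alone may satisfy some `F_{r,y}`.
No edge starts at an element satisfying some `F_{r,y}`, so `C` can be false. -/
def layeredModel (const : MSAConst P K → D) (rel : P → List D → Prop) (X : Set D) :
    Interp (MSAPred P K) (MSAConst P K) D where
  const := const
  rel
    | .orig p, l => rel p l
    | .F _ _, l => ∀ d ∈ l, d ∉ X
    | .S, l => ∃ d ∈ l.head?, d ∈ X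
    | .D, l => ∃ d ∈ l.head?, d ∈ X
    | .C, _ => False

variable {const : MSAConst P K → D} {rel : P → List D → Prop} {X : Set D} {R : Set (Rule P K)}

theorem layeredModel_satRule
    (main : ∀ r ∈ R, ∀ v, (layeredModel const rel X).SatConj v (msaBody r) →
      (layeredModel const rel X).SatConj v (msaMain r).2)
    (const_sk : ∀ r ∈ R, ∀ y, IsExistential r y → const (.sk r y) ∉ X)
    (frontier : ∀ r ∈ R, ∀ y, IsExistential r y → ∀ v,
      (layeredModel const rel X).SatConj v (msaBody r) → ∀ x, IsFrontier r x → v x ∈ X)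
    {ρ : Rule (MSAPred P K) (MSAConst P K)} (hρ : MSAProgram R ρ) :
    (layeredModel const rel X).SatRule ρ := by
  refine fun v hv => ⟨v, fun _ _ => rfl, ?_⟩
  cases hρ with
  | main r hr => exact main r hr v hv
  | mark r hr y hy =>
    simpa [Interp.SatAtom, Interp.val, layeredModel] using const_sk r hr y hy
  | succ r hr y hy x hx =>
    simpa [Interp.SatAtom, Interp.val, layeredModel] using frontier r hr y hy v hv x hx
  | base => simpa [Interp.SatAtom, Interp.val, layeredModel] using hv
  | step =>
    rw [Interp.satConj_cons] at hv
    simpa [Interp.SatAtom, Interp.val, layeredModel] using hv.1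
  | cycle r hr y hy =>
    have ⟨notMem, mem, _⟩ : v 0 ∉ X ∧ v 0 ∈ X ∧ v 1 ∉ X := by
      simpa [Interp.SatAtom, Interp.val, layeredModel] using hv
    exact absurd mem notMem

theorem isMSA_of_layeredModel
    (critical : ∀ p l, (∀ d ∈ l, ∃ c, CritConst R c ∧ const c = d) → rel p l)
    (main : ∀ r ∈ R, ∀ v, (layeredModel const rel X).SatConj v (msaBody r) →
      (layeredModel const rel X).SatConj v (msaMain r).2)
    (const_sk : ∀ r ∈ R, ∀ y, IsExistential r y → const (.sk r y) ∉ X)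
    (frontier : ∀ r ∈ R, ∀ y, IsExistential r y → ∀ v,
      (layeredModel const rel X).SatConj v (msaBody r) → ∀ x, IsFrontier r x → v x ∈ X) :
    IsMSA R := by
  have facts : ∀ a ∈ criticalInstance R, (layeredModel const rel X).SatCQ [a] := by
    rintro ⟨p, ts⟩ ⟨r, -, b, -, rfl : p = _, -, hts⟩
    refine ⟨fun _ => const .star, List.forall_mem_singleton.2 (critical b.1 _ ?_)⟩
    refine List.forall_mem_map.2 fun t ht => ?_
    obtain ⟨c, hc, rfl⟩ := hts t ht
    exact ⟨c, hc, rfl⟩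
  intro entails
  obtain ⟨v, hv⟩ := entails D _ facts
    fun ρ hρ => layeredModel_satRule main const_sk frontier hρ
  exact List.forall_mem_singleton.1 hv

end Acyclicity

/-! ### The rules -/

/-- The predicate `y = x + 1`. -/
abbrev nextP : ℕ := 0
/-- The predicate `t` whose transitivity lets `extendRule` fire on its own output. -/
abbrev transP : ℕ := 1
/-- The predicate `x = 0`. -/
abbrev zeroP : ℕ := 2
/-- The predicate `z = x + y`. -/
abbrev addP : ℕ := 3
/-- The predicate `z = x * y`. -/
abbrev mulP : ℕ := 4
/-- The predicate `z = Nat.pair x y`. -/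
abbrev pairP : ℕ := 5
/-- The predicate `y ∈ eval c x`. -/
abbrev evalP (c : Code) : ℕ := encode c + 6

/-- `next(x, y) ∧ t(y, x) → ∃ z u, next(y, z) ∧ t(z, u) ∧ t(u, y)`. -/
def extendRule : Rule ℕ ℕ :=
  ([varAtom nextP [0, 1], varAtom transP [1, 0]],
    [varAtom nextP [1, 2], varAtom transP [2, 3], varAtom transP [3, 1]])

/-- Transitivity of `transP`. -/
def transRule : Rule ℕ ℕ :=
  ([varAtom transP [0, 1], varAtom transP [1, 2]], [varAtom transP [0, 2]])

/-- The recursive definition of addition. The atom `next(x, y)` in the body of its first rule makes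
the rule safe: `x` has to occur in the body. -/
def addRules : List (Rule ℕ ℕ) :=
  [([varAtom nextP [0, 1], varAtom zeroP [2]], [varAtom addP [0, 2, 0]]),
    ([varAtom addP [0, 1, 2], varAtom nextP [1, 3], varAtom nextP [2, 4]],
      [varAtom addP [0, 3, 4]])]

/-- The recursive definition of multiplication. -/
def mulRules : List (Rule ℕ ℕ) :=
  [([varAtom nextP [0, 1], varAtom zeroP [2]], [varAtom mulP [0, 2, 2]]),
    ([varAtom mulP [0, 1, 2], varAtom nextP [1, 3], varAtom addP [2, 0, 4]],
      [varAtom mulP [0, 3, 4]])]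

/-- The two cases of `Nat.pair a b`: it is `b * b + a` if `b = a + (k + 1)`, and `a * a + a + b` if
`a = b + k`. -/
def pairRules : List (Rule ℕ ℕ) :=
  [([varAtom nextP [0, 1], varAtom addP [2, 1, 3], varAtom mulP [3, 3, 4],
      varAtom addP [4, 2, 5]], [varAtom pairP [2, 3, 5]]),
    ([varAtom addP [0, 1, 2], varAtom mulP [2, 2, 3], varAtom addP [3, 2, 4],
      varAtom addP [4, 0, 5]], [varAtom pairP [2, 0, 5]])]

/-- The rules that derive `evalP c` from the evaluation of the immediate subcodes of `c`. -/
def stepRules : Code → List (Rule ℕ ℕ)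
  | .zero => [([varAtom nextP [0, 1], varAtom zeroP [2]], [varAtom (evalP .zero) [0, 2]])]
  | .succ => [([varAtom nextP [0, 1]], [varAtom (evalP .succ) [0, 1]])]
  | .left => [([varAtom pairP [0, 1, 2]], [varAtom (evalP .left) [2, 0]])]
  | .right => [([varAtom pairP [0, 1, 2]], [varAtom (evalP .right) [2, 1]])]
  | .pair f g =>
    [([varAtom (evalP f) [0, 1], varAtom (evalP g) [0, 2], varAtom pairP [1, 2, 3]],
      [varAtom (evalP (.pair f g)) [0, 3]])]
  | .comp f g =>
    [([varAtom (evalP g) [0, 1], varAtom (evalP f) [1, 2]], [varAtom (evalP (.comp f g)) [0, 2]])]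
  | .prec f g =>
    [([varAtom zeroP [0], varAtom pairP [1, 0, 2], varAtom (evalP f) [1, 3]],
      [varAtom (evalP (.prec f g)) [2, 3]]),
    ([varAtom pairP [0, 1, 2], varAtom (evalP (.prec f g)) [2, 3], varAtom pairP [1, 3, 4],
      varAtom pairP [0, 4, 5], varAtom (evalP g) [5, 6], varAtom nextP [1, 7],
      varAtom pairP [0, 7, 8]], [varAtom (evalP (.prec f g)) [8, 6]])]
  | .rfind' f =>
    [([varAtom pairP [0, 1, 2], varAtom (evalP f) [2, 3], varAtom zeroP [3]],
      [varAtom (evalP (.rfind' f)) [2, 1]]),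
    ([varAtom pairP [0, 1, 2], varAtom (evalP f) [2, 3], varAtom nextP [4, 3],
      varAtom nextP [1, 5], varAtom pairP [0, 5, 6], varAtom (evalP (.rfind' f)) [6, 7]],
      [varAtom (evalP (.rfind' f)) [2, 7]])]

/-- The subcodes of a code, including the code itself. -/
def subcodes : Code → List Code
  | .zero => [.zero]
  | .succ => [.succ]
  | .left => [.left]
  | .right => [.right]
  | .pair f g => .pair f g :: (subcodes f ++ subcodes g)
  | .comp f g => .comp f g :: (subcodes f ++ subcodes g)
  | .prec f g => .prec f g :: (subcodes f ++ subcodes g)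
  | .rfind' f => .rfind' f :: subcodes f

/-- The Datalog rules that evaluate `c`. -/
def evalRules (c : Code) : List (Rule ℕ ℕ) :=
  addRules ++ mulRules ++ pairRules ++ (subcodes c).flatMap stepRules

theorem forall_mem_evalRules {c : Code} {p : Rule ℕ ℕ → Prop} :
    (∀ r ∈ evalRules c, p r) ↔ (∀ r ∈ addRules, p r) ∧ (∀ r ∈ mulRules, p r) ∧
      (∀ r ∈ pairRules, p r) ∧ ∀ c' ∈ subcodes c, ∀ r ∈ stepRules c', p r := by
  simp only [evalRules, List.forall_mem_append, List.forall_mem_flatMap, and_assoc]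

/-- A Datalog rule with non-empty body and head, whose head predicates are neither `nextP` nor
`transP`. -/
structure IsDerivationRule (r : Rule ℕ ℕ) : Prop where
  body_ne_nil : r.1 ≠ []
  head_ne_nil : r.2 ≠ []
  isDatalog : IsDatalog r
  two_le_head : ∀ a ∈ r.2, 2 ≤ a.1

theorem isDerivationRule_iff {r : Rule ℕ ℕ} :
    IsDerivationRule r ↔ r.1 ≠ [] ∧ r.2 ≠ [] ∧ IsDatalog r ∧ ∀ a ∈ r.2, 2 ≤ a.1 :=
  ⟨fun ⟨h₁, h₂, h₃, h₄⟩ => ⟨h₁, h₂, h₃, h₄⟩, fun ⟨h₁, h₂, h₃, h₄⟩ => ⟨h₁, h₂, h₃, h₄⟩⟩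

theorem isDerivationRule_of_mem_addRules : ∀ r ∈ addRules, IsDerivationRule r := by
  simp only [addRules, List.forall_mem_cons]
  simp [isDerivationRule_iff, IsDatalog, addP]

theorem isDerivationRule_of_mem_mulRules : ∀ r ∈ mulRules, IsDerivationRule r := by
  simp only [mulRules, List.forall_mem_cons]
  simp [isDerivationRule_iff, IsDatalog, mulP]

theorem isDerivationRule_of_mem_pairRules : ∀ r ∈ pairRules, IsDerivationRule r := by
  simp only [pairRules, List.forall_mem_cons]
  simp [isDerivationRule_iff, IsDatalog, pairP]

theorem isDerivationRule_of_mem_stepRules (c : Code) : ∀ r ∈ stepRules c, IsDerivationRule r := by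
  cases c <;> simp only [stepRules, List.forall_mem_cons] <;> simp [isDerivationRule_iff, IsDatalog]

theorem isDerivationRule_of_mem_evalRules (c : Code) : ∀ r ∈ evalRules c, IsDerivationRule r :=
  forall_mem_evalRules.2 ⟨isDerivationRule_of_mem_addRules, isDerivationRule_of_mem_mulRules,
    isDerivationRule_of_mem_pairRules, fun sub _ => isDerivationRule_of_mem_stepRules sub⟩

/-! ### Acyclicity of the rules -/

/-- The constants of the summarizing program in three classes: `0` for `∗` and the constants of the
rules, `1` and `2` for the constants of the variables `z = 2` and `u = 3` of `extendRule`. -/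
def summaryConst : MSAConst ℕ ℕ → Fin 3
  | .orig _ => 0
  | .star => 0
  | .sk _ y => if y = 2 then 1 else 2

/-- The atoms over `Fin 3` that a single application of `extendRule` adds to the critical instance,
where every derived predicate is taken to be universal. -/
def summaryRel : ℕ → List (Fin 3) → Prop
  | 0, l => (∀ d ∈ l, d = 0) ∨ l = [0, 1]
  | 1, l => (∀ d ∈ l, d = 0) ∨ l = [1, 2] ∨ l = [2, 0]
  | _, _ => True

theorem summaryRel_of_forall_eq_zero {p : ℕ} {l : List (Fin 3)} (hl : ∀ d ∈ l, d = 0) :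
    summaryRel p l := by
  match p with
  | 0 => exact .inl hl
  | 1 => exact .inl hl
  | _ + 2 => trivial

theorem summaryRel_of_two_le {p : ℕ} (hp : 2 ≤ p) (l : List (Fin 3)) : summaryRel p l := by
  obtain ⟨k, rfl⟩ := Nat.exists_eq_add_of_le' hp
  trivial

/-- `t` holds backwards along the edge `(0, 0)` of `next` but not along the new edge `(0, 1)`. -/
theorem eq_zero_of_summaryRel_next_trans {a b : Fin 3} (next : summaryRel nextP [a, b])
    (back : summaryRel transP [b, a]) : b = 0 := by
  simp only [summaryRel] at next back
  revert a b
  decide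

theorem eq_zero_of_satConj_msaBody_extendRule {v : ℕ → Fin 3}
    (hv : (layeredModel summaryConst summaryRel {0}).SatConj v (msaBody extendRule)) : v 1 = 0 := by
  have ⟨next, back⟩ := List.forall_mem_cons.1 hv
  exact eq_zero_of_summaryRel_next_trans next (back _ List.mem_cons_self)

theorem isMSA_of_forall_isDerivationRule {R : Set (Rule ℕ ℕ)}
    (hR : ∀ r ∈ R, r = extendRule ∨ IsDerivationRule r) : IsMSA R := by
  have eq_extendRule : ∀ r ∈ R, ∀ y, IsExistential r y → r = extendRule := fun r hr y hy =>
    (hR r hr).resolve_right fun h => hy.1 (h.isDatalog y hy.2)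
  refine isMSA_of_layeredModel (const := summaryConst) (rel := summaryRel) (X := {0}) ?_ ?_ ?_ ?_
  · intro p l hl
    refine summaryRel_of_forall_eq_zero fun d hd => ?_
    obtain ⟨c, hc, rfl⟩ := hl d hd
    cases hc <;> rfl
  · intro r hr v hv
    rcases hR r hr with rfl | h
    · have h1 := eq_zero_of_satConj_msaBody_extendRule hv
      simp [msaMain, extendRule, varAtom, skTerm, Interp.SatAtom, layeredModel, Interp.val,
        summaryConst, summaryRel, h1]
    · exact List.forall_mem_map.2 fun a ha => summaryRel_of_two_le (h.two_le_head a ha) _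
  · intro r _ y _
    by_cases h : y = 2 <;> simp [summaryConst, h]
  · intro r hr y hy v hv x hx
    obtain rfl := eq_extendRule r hr y hy
    obtain rfl : x = 1 := by
      have : (x = 0 ∨ x = 1 ∨ x = 0) ∧ (x = 1 ∨ x = 2 ∨ x = 3 ∨ x = 1) := by
        simpa [IsFrontier, extendRule, or_assoc] using hx
      omega
    exact eq_zero_of_satConj_msaBody_extendRule hv

/-! ### Evaluation of codes -/

theorem mem_eval_pair {f g : Code} {x y : ℕ} :
    y ∈ eval (.pair f g) x ↔ ∃ a ∈ eval f x, ∃ b ∈ eval g x, Nat.pair a b = y := by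
  simp [eval, Seq.seq, Part.mem_bind_iff]

theorem mem_eval_comp {f g : Code} {x y : ℕ} :
    y ∈ eval (.comp f g) x ↔ ∃ a ∈ eval g x, y ∈ eval f a :=
  Part.mem_bind_iff

theorem mem_eval_rfind' {f : Code} {a m y : ℕ} :
    y ∈ eval (.rfind' f) (Nat.pair a m) ↔
      ∃ n, (0 ∈ eval f (Nat.pair a (n + m)) ∧
        ∀ i < n, ∃ k, k + 1 ∈ eval f (Nat.pair a (i + m))) ∧ n + m = y := by
  simp only [eval, Nat.unpaired, Nat.unpair_pair]
  refine (Part.mem_map_iff _).trans (exists_congr fun n => and_congr_left fun _ => ?_)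
  refine Nat.mem_rfind.trans (and_congr ?_ (forall₂_congr fun i _ => ?_))
  · simp
  · refine (Part.mem_map_iff _).trans ⟨fun ⟨k, hk, ne_zero⟩ => ?_, fun ⟨k, hk⟩ => ⟨_, hk, by simp⟩⟩
    obtain ⟨j, rfl⟩ := Nat.exists_eq_succ_of_ne_zero (of_decide_eq_false ne_zero)
    exact ⟨j, hk⟩

theorem mem_eval_rfind'_of_zero_mem {f : Code} {a m : ℕ} (h : 0 ∈ eval f (Nat.pair a m)) :
    m ∈ eval (.rfind' f) (Nat.pair a m) :=
  mem_eval_rfind'.2 ⟨0, by simpa using h⟩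

theorem mem_eval_rfind'_of_succ_mem {f : Code} {a m k y : ℕ} (h : k + 1 ∈ eval f (Nat.pair a m))
    (hy : y ∈ eval (.rfind' f) (Nat.pair a (m + 1))) : y ∈ eval (.rfind' f) (Nat.pair a m) := by
  obtain ⟨n, ⟨h0, hlt⟩, rfl⟩ := mem_eval_rfind'.1 hy
  have shift (i : ℕ) : i + 1 + m = i + (m + 1) := by omega
  refine mem_eval_rfind'.2 ⟨n + 1, ⟨by rwa [shift], fun i hi => ?_⟩, shift n⟩
  cases i with
  | zero => exact ⟨k, by simpa using h⟩
  | succ i => simpa only [shift] using hlt i (by omega)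

theorem eval_rfind'_induction {f : Code} {a : ℕ} {motive : ℕ → ℕ → Prop}
    (found : ∀ m, 0 ∈ eval f (Nat.pair a m) → motive m m)
    (search : ∀ m k y, k + 1 ∈ eval f (Nat.pair a m) → motive (m + 1) y → motive m y)
    {m y : ℕ} (hy : y ∈ eval (.rfind' f) (Nat.pair a m)) : motive m y := by
  obtain ⟨n, ⟨h0, hlt⟩, rfl⟩ := mem_eval_rfind'.1 hy
  clear hy
  induction n generalizing m with
  | zero => simpa using found m (by simpa using h0)
  | succ n ih =>
    have shift (i : ℕ) : i + 1 + m = i + (m + 1) := by omega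
    obtain ⟨k, hk⟩ := hlt 0 n.succ_pos
    rw [Nat.zero_add] at hk
    rw [shift] at h0 ⊢
    refine search m k _ hk (ih h0 fun i hi => ?_)
    simpa only [shift] using hlt (i + 1) (by omega)

/-! ### Soundness -/

/-- The intended model, on the natural numbers. The predicate `t` is universal, so `extendRule` and
transitivity impose nothing on it. -/
def natModel : Interp ℕ ℕ ℕ where
  const := id
  rel
    | 0, [x, y] => y = x + 1
    | 1, _ => True
    | 2, [x] => x = 0
    | 3, [x, y, z] => z = x + y
    | 4, [x, y, z] => z = x * y
    | 5, [x, y, z] => z = Nat.pair x y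
    | k + 6, [x, y] => y ∈ eval (ofNat Code k) x
    | _, _ => False

section natModel

variable (x y z : ℕ) (l : List ℕ)

@[simp] theorem natModel_next : natModel.rel nextP [x, y] ↔ y = x + 1 := Iff.rfl
@[simp] theorem natModel_trans : natModel.rel transP l ↔ True := by cases l <;> rfl
@[simp] theorem natModel_zero : natModel.rel zeroP [x] ↔ x = 0 := Iff.rfl
@[simp] theorem natModel_add : natModel.rel addP [x, y, z] ↔ z = x + y := Iff.rfl
@[simp] theorem natModel_mul : natModel.rel mulP [x, y, z] ↔ z = x * y := Iff.rfl
@[simp] theorem natModel_pair : natModel.rel pairP [x, y, z] ↔ z = Nat.pair x y := Iff.rfl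
@[simp] theorem natModel_eval (c : Code) : natModel.rel (evalP c) [x, y] ↔ y ∈ eval c x := by
  change y ∈ eval (ofNat Code (encode c)) x ↔ _
  rw [Denumerable.ofNat_encode]

end natModel

theorem natModel_extendRule : natModel.SatRule extendRule := by
  intro v _
  refine ⟨Function.update v 2 (v 1 + 1), fun x hx => Function.update_of_ne ?_ _ _, ?_⟩
  · rintro rfl
    simp [extendRule] at hx
  · simp [extendRule]

theorem natModel_transRule : natModel.SatRule transRule :=
  fun v _ => ⟨v, fun _ _ => rfl, by simp [transRule]⟩

theorem natModel_addRules : ∀ r ∈ addRules, natModel.SatRule r := by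
  rw [natModel.forall_satRule_iff_of_isDatalog fun r hr =>
    (isDerivationRule_of_mem_addRules r hr).isDatalog]
  simp +contextual [addRules, Nat.add_assoc]

theorem natModel_mulRules : ∀ r ∈ mulRules, natModel.SatRule r := by
  rw [natModel.forall_satRule_iff_of_isDatalog fun r hr =>
    (isDerivationRule_of_mem_mulRules r hr).isDatalog]
  simp +contextual [mulRules, Nat.mul_succ]

theorem natModel_pairRules : ∀ r ∈ pairRules, natModel.SatRule r := by
  rw [natModel.forall_satRule_iff_of_isDatalog fun r hr =>
    (isDerivationRule_of_mem_pairRules r hr).isDatalog]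
  simp +contextual [pairRules, Nat.pair]

theorem natModel_stepRules (c : Code) : ∀ r ∈ stepRules c, natModel.SatRule r := by
  rw [natModel.forall_satRule_iff_of_isDatalog fun r hr =>
    (isDerivationRule_of_mem_stepRules c r hr).isDatalog]
  cases c with
  | zero => simp [stepRules, eval, pure, PFun.pure]
  | succ => simp [stepRules, eval]
  | left => simp +contextual [stepRules, eval]
  | right => simp +contextual [stepRules, eval]
  | pair f g =>
    simp only [stepRules, List.forall_mem_singleton, Interp.satConj_cons, Interp.satConj_nil,
      Interp.satAtom_varAtom, List.map, natModel_eval, natModel_pair, and_true, and_imp]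
    exact fun v ha hb hpair => mem_eval_pair.2 ⟨_, ha, _, hb, hpair.symm⟩
  | comp f g =>
    simp only [stepRules, List.forall_mem_singleton, Interp.satConj_cons, Interp.satConj_nil,
      Interp.satAtom_varAtom, List.map, natModel_eval, and_true, and_imp]
    exact fun v ha hy => mem_eval_comp.2 ⟨_, ha, hy⟩
  | prec f g =>
    simp only [stepRules, List.forall_mem_cons, Interp.satConj_cons, Interp.satConj_nil,
      Interp.satAtom_varAtom, List.map, natModel_eval, natModel_pair, natModel_zero,
      natModel_next, and_true, and_imp]
    refine ⟨fun v h0 h2 hf => ?_, fun v h2 hrec h4 h5 hg h7 h8 => ?_, by simp⟩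
    · rwa [h2, h0, eval_prec_zero]
    · rw [h8, h7, eval_prec_succ]
      rw [h2] at hrec
      rw [h5, h4] at hg
      exact Part.mem_bind hrec hg
  | rfind' f =>
    simp only [stepRules, List.forall_mem_cons, Interp.satConj_cons, Interp.satConj_nil,
      Interp.satAtom_varAtom, List.map, natModel_eval, natModel_pair, natModel_zero,
      natModel_next, and_true, and_imp]
    refine ⟨fun v h2 hf h3 => ?_, fun v h2 hf h3 h5 h6 hrec => ?_, by simp⟩
    · rw [h2, h3] at hf
      rw [h2]
      exact mem_eval_rfind'_of_zero_mem hf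
    · rw [h2, h3] at hf
      rw [h6, h5] at hrec
      rw [h2]
      exact mem_eval_rfind'_of_succ_mem hf hrec

theorem natModel_evalRules (c : Code) : ∀ r ∈ evalRules c, natModel.SatRule r :=
  forall_mem_evalRules.2
    ⟨natModel_addRules, natModel_mulRules, natModel_pairRules, fun sub _ => natModel_stepRules sub⟩

/-! ### Completeness -/

section Completeness

variable {D : Type} {I : Interp ℕ ℕ D} {d : ℕ → D}

/-- `d` interprets the natural numbers in `I`, as far as `nextP` and `zeroP` are concerned. It need
not be injective. -/
structure IsNumbering (I : Interp ℕ ℕ D) (d : ℕ → D) : Prop where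
  next (i : ℕ) : I.rel nextP [d i, d (i + 1)]
  zero : I.rel zeroP [d 0]

/-- The assignment that sends the variable `k` to the image under `d` of the `k`-th entry of
`xs`; the default value `0` for the other variables is irrelevant. -/
def along (d : ℕ → D) (xs : List ℕ) : ℕ → D := fun k => d (xs.getD k 0)

theorem IsNumbering.add (hd : IsNumbering I d) (h : ∀ r ∈ addRules, I.SatRule r) (x y : ℕ) :
    I.rel addP [d x, d y, d (x + y)] := by
  rw [I.forall_satRule_iff_of_isDatalog fun r hr =>
    (isDerivationRule_of_mem_addRules r hr).isDatalog] at h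
  simp only [addRules, List.forall_mem_cons, Interp.satConj_cons, Interp.satConj_nil,
    Interp.satAtom_varAtom, List.map, and_true, and_imp] at h
  obtain ⟨add_zero, add_succ, -⟩ := h
  induction y with
  | zero => exact add_zero (along d [x, x + 1, 0]) (hd.next x) hd.zero
  | succ y ih =>
    exact add_succ (along d [x, y, x + y, y + 1, x + y + 1]) ih (hd.next y) (hd.next _)

theorem IsNumbering.mul (hd : IsNumbering I d) (hadd : ∀ x y, I.rel addP [d x, d y, d (x + y)])
    (h : ∀ r ∈ mulRules, I.SatRule r) (x y : ℕ) : I.rel mulP [d x, d y, d (x * y)] := by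
  rw [I.forall_satRule_iff_of_isDatalog fun r hr =>
    (isDerivationRule_of_mem_mulRules r hr).isDatalog] at h
  simp only [mulRules, List.forall_mem_cons, Interp.satConj_cons, Interp.satConj_nil,
    Interp.satAtom_varAtom, List.map, and_true, and_imp] at h
  obtain ⟨mul_zero, mul_succ, -⟩ := h
  induction y with
  | zero => exact mul_zero (along d [x, x + 1, 0]) (hd.next x) hd.zero
  | succ y ih => exact mul_succ (along d [x, y, x * y, y + 1, x * y + x]) ih (hd.next y) (hadd _ _)

theorem IsNumbering.pair (hd : IsNumbering I d) (hadd : ∀ x y, I.rel addP [d x, d y, d (x + y)])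
    (hmul : ∀ x y, I.rel mulP [d x, d y, d (x * y)]) (h : ∀ r ∈ pairRules, I.SatRule r)
    (x y : ℕ) : I.rel pairP [d x, d y, d (Nat.pair x y)] := by
  rw [I.forall_satRule_iff_of_isDatalog fun r hr =>
    (isDerivationRule_of_mem_pairRules r hr).isDatalog] at h
  simp only [pairRules, List.forall_mem_cons, Interp.satConj_cons, Interp.satConj_nil,
    Interp.satAtom_varAtom, List.map, and_true, and_imp] at h
  obtain ⟨pair_of_lt, pair_of_le, -⟩ := h
  rw [Nat.pair]
  split_ifs with hxy
  · obtain ⟨k, rfl⟩ := Nat.exists_eq_add_of_lt hxy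
    let y := x + k + 1
    exact pair_of_lt (along d [k, k + 1, x, y, y * y, y * y + x])
      (hd.next k) (hadd x (k + 1)) (hmul _ _) (hadd _ _)
  · obtain ⟨k, rfl⟩ := Nat.exists_eq_add_of_le (not_lt.1 hxy)
    let x := y + k
    exact pair_of_le (along d [y, k, x, x * x, x * x + x, x * x + x + y])
      (hadd _ _) (hmul _ _) (hadd _ _) (hadd _ _)

/-- The predicate `evalP c` of `I` contains the graph of `eval c`, transported along `d`. -/
def RepresentsEval (I : Interp ℕ ℕ D) (d : ℕ → D) (c : Code) : Prop :=
  ∀ x y, y ∈ eval c x → I.rel (evalP c) [d x, d y]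

theorem representsEval_of_forall_pair {c : Code}
    (h : ∀ a n y, y ∈ eval c (Nat.pair a n) → I.rel (evalP c) [d (Nat.pair a n), d y]) :
    RepresentsEval I d c := by
  intro x y
  simpa only [Nat.pair_unpair] using h x.unpair.1 x.unpair.2 y

theorem forall_stepRules_iff {c : Code} : (∀ r ∈ stepRules c, I.SatRule r) ↔
    ∀ r ∈ stepRules c, ∀ v, I.SatConj v r.1 → I.SatConj v r.2 :=
  I.forall_satRule_iff_of_isDatalog fun r hr =>
    (isDerivationRule_of_mem_stepRules c r hr).isDatalog

namespace RepresentsEval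

variable {f g : Code}

theorem zero (hd : IsNumbering I d) (h : ∀ r ∈ stepRules .zero, I.SatRule r) :
    RepresentsEval I d .zero := by
  rw [forall_stepRules_iff] at h
  simp only [stepRules, List.forall_mem_singleton, Interp.satConj_cons,
    Interp.satConj_nil, Interp.satAtom_varAtom, List.map, and_true, and_imp] at h
  intro x y hy
  obtain rfl : y = 0 := by simpa [eval, Pure.pure, PFun.pure] using hy
  exact h (along d [x, x + 1, 0]) (hd.next x) hd.zero

theorem succ (hd : IsNumbering I d) (h : ∀ r ∈ stepRules .succ, I.SatRule r) :
    RepresentsEval I d .succ := by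
  rw [forall_stepRules_iff] at h
  simp only [stepRules, List.forall_mem_singleton, Interp.satConj_cons,
    Interp.satConj_nil, Interp.satAtom_varAtom, List.map, and_true] at h
  intro x y hy
  obtain rfl : y = x + 1 := by simpa [eval] using hy
  exact h (along d [x, x + 1]) (hd.next x)

theorem left (hpair : ∀ x y, I.rel pairP [d x, d y, d (Nat.pair x y)])
    (h : ∀ r ∈ stepRules .left, I.SatRule r) : RepresentsEval I d .left := by
  rw [forall_stepRules_iff] at h
  simp only [stepRules, List.forall_mem_singleton, Interp.satConj_cons,
    Interp.satConj_nil, Interp.satAtom_varAtom, List.map, and_true] at h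
  refine representsEval_of_forall_pair fun a n y hy => ?_
  obtain rfl : y = a := by simpa [eval] using hy
  exact h (along d [y, n, Nat.pair y n]) (hpair _ _)

theorem right (hpair : ∀ x y, I.rel pairP [d x, d y, d (Nat.pair x y)])
    (h : ∀ r ∈ stepRules .right, I.SatRule r) : RepresentsEval I d .right := by
  rw [forall_stepRules_iff] at h
  simp only [stepRules, List.forall_mem_singleton, Interp.satConj_cons,
    Interp.satConj_nil, Interp.satAtom_varAtom, List.map, and_true] at h
  refine representsEval_of_forall_pair fun a n y hy => ?_
  obtain rfl : y = n := by simpa [eval] using hy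
  exact h (along d [a, y, Nat.pair a y]) (hpair _ _)

theorem pair (hpair : ∀ x y, I.rel pairP [d x, d y, d (Nat.pair x y)])
    (h : ∀ r ∈ stepRules (.pair f g), I.SatRule r) (hf : RepresentsEval I d f)
    (hg : RepresentsEval I d g) : RepresentsEval I d (.pair f g) := by
  rw [forall_stepRules_iff] at h
  simp only [stepRules, List.forall_mem_singleton, Interp.satConj_cons,
    Interp.satConj_nil, Interp.satAtom_varAtom, List.map, and_true, and_imp] at h
  intro x y hy
  obtain ⟨a, ha, b, hb, rfl⟩ := mem_eval_pair.1 hy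
  exact h (along d [x, a, b, Nat.pair a b]) (hf _ _ ha) (hg _ _ hb) (hpair a b)

theorem comp (h : ∀ r ∈ stepRules (.comp f g), I.SatRule r) (hf : RepresentsEval I d f)
    (hg : RepresentsEval I d g) : RepresentsEval I d (.comp f g) := by
  rw [forall_stepRules_iff] at h
  simp only [stepRules, List.forall_mem_singleton, Interp.satConj_cons,
    Interp.satConj_nil, Interp.satAtom_varAtom, List.map, and_true, and_imp] at h
  intro x y hy
  obtain ⟨a, ha, hy⟩ := mem_eval_comp.1 hy
  exact h (along d [x, a, y]) (hg _ _ ha) (hf _ _ hy)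

theorem prec (hd : IsNumbering I d) (hpair : ∀ x y, I.rel pairP [d x, d y, d (Nat.pair x y)])
    (h : ∀ r ∈ stepRules (.prec f g), I.SatRule r) (hf : RepresentsEval I d f)
    (hg : RepresentsEval I d g) : RepresentsEval I d (.prec f g) := by
  rw [forall_stepRules_iff] at h
  simp only [stepRules, List.forall_mem_cons, Interp.satConj_cons,
    Interp.satConj_nil, Interp.satAtom_varAtom, List.map, and_true, and_imp] at h
  obtain ⟨prec_zero, prec_succ, -⟩ := h
  refine representsEval_of_forall_pair fun a n => ?_
  induction n with
  | zero =>
    intro y hy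
    rw [eval_prec_zero] at hy
    exact prec_zero (along d [0, a, Nat.pair a 0, y]) hd.zero (hpair a 0) (hf _ _ hy)
  | succ n ih =>
    intro y hy
    rw [eval_prec_succ] at hy
    obtain ⟨i, hi, hy⟩ := Part.mem_bind_iff.1 hy
    exact prec_succ (along d [a, n, Nat.pair a n, i, Nat.pair n i, Nat.pair a (Nat.pair n i), y,
      n + 1, Nat.pair a (n + 1)]) (hpair _ _) (ih i hi) (hpair _ _) (hpair _ _) (hg _ _ hy)
      (hd.next n) (hpair _ _)

theorem rfind' (hd : IsNumbering I d) (hpair : ∀ x y, I.rel pairP [d x, d y, d (Nat.pair x y)])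
    (h : ∀ r ∈ stepRules (.rfind' f), I.SatRule r) (hf : RepresentsEval I d f) :
    RepresentsEval I d (.rfind' f) := by
  rw [forall_stepRules_iff] at h
  simp only [stepRules, List.forall_mem_cons, Interp.satConj_cons,
    Interp.satConj_nil, Interp.satAtom_varAtom, List.map, and_true, and_imp] at h
  obtain ⟨found, search, -⟩ := h
  refine representsEval_of_forall_pair fun a m y hy => ?_
  refine eval_rfind'_induction
    (motive := fun m y => I.rel (evalP (.rfind' f)) [d (Nat.pair a m), d y])
    (fun m h0 => ?_) (fun m k y hk ih => ?_) hy
  · exact found (along d [a, m, Nat.pair a m, 0]) (hpair _ _) (hf _ _ h0) hd.zero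
  · exact search (along d [a, m, Nat.pair a m, k + 1, k, m + 1, Nat.pair a (m + 1), y]) (hpair _ _)
      (hf _ _ hk) (hd.next k) (hd.next m) (hpair _ _) ih

end RepresentsEval

theorem representsEval_of_stepRules (hd : IsNumbering I d)
    (hpair : ∀ x y, I.rel pairP [d x, d y, d (Nat.pair x y)]) (c : Code)
    (h : ∀ c' ∈ subcodes c, ∀ r ∈ stepRules c', I.SatRule r) : RepresentsEval I d c := by
  induction c with
  | zero => exact .zero hd (List.forall_mem_singleton.1 h)
  | succ => exact .succ hd (List.forall_mem_singleton.1 h)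
  | left => exact .left hpair (List.forall_mem_singleton.1 h)
  | right => exact .right hpair (List.forall_mem_singleton.1 h)
  | pair f g ihf ihg =>
    simp only [subcodes, List.forall_mem_cons, List.forall_mem_append] at h
    exact .pair hpair h.1 (ihf h.2.1) (ihg h.2.2)
  | comp f g ihf ihg =>
    simp only [subcodes, List.forall_mem_cons, List.forall_mem_append] at h
    exact .comp h.1 (ihf h.2.1) (ihg h.2.2)
  | prec f g ihf ihg =>
    simp only [subcodes, List.forall_mem_cons, List.forall_mem_append] at h
    exact .prec hd hpair h.1 (ihf h.2.1) (ihg h.2.2)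
  | rfind' f ih =>
    simp only [subcodes, List.forall_mem_cons] at h
    exact .rfind' hd hpair h.1 (ih h.2)

theorem IsNumbering.representsEval (hd : IsNumbering I d) {c : Code}
    (h : ∀ r ∈ evalRules c, I.SatRule r) : RepresentsEval I d c := by
  obtain ⟨add, mul, pair, step⟩ := forall_mem_evalRules.1 h
  exact representsEval_of_stepRules hd (hd.pair (hd.add add) (hd.mul (hd.add add) mul) pair) c step

theorem exists_next_of_extendRule (extend : I.SatRule extendRule) (trans : I.SatRule transRule)
    {x y : D} (next : I.rel nextP [x, y]) (back : I.rel transP [y, x]) :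
    ∃ z, I.rel nextP [y, z] ∧ I.rel transP [z, y] := by
  obtain ⟨w, w_eq, hw⟩ := extend (fun k => if k = 0 then x else y)
    (by simpa [extendRule] using ⟨next, back⟩)
  have w_one : w 1 = y := by simpa using w_eq 1 (by simp [extendRule])
  have ⟨next_z, back_zu, back_uy⟩ :
      I.rel nextP [y, w 2] ∧ I.rel transP [w 2, w 3] ∧ I.rel transP [w 3, y] := by
    simpa [extendRule, w_one] using hw
  rw [I.satRule_iff_of_isDatalog (by simp [IsDatalog, transRule])] at trans
  have back_zy := trans (fun k => if k = 0 then w 2 else if k = 1 then w 3 else y)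
    (by simpa [transRule] using ⟨back_zu, back_uy⟩)
  exact ⟨w 2, next_z, by simpa [transRule] using back_zy⟩

end Completeness

theorem exists_seq_prolonging {α : Type*} {r : α → α → Prop}
    (extend : ∀ x y, r x y → ∃ z, r y z) (e : ℕ → α) (n : ℕ) (he : ∀ i ≤ n, r (e i) (e (i + 1))) :
    ∃ d : ℕ → α, (∀ i ≤ n, d i = e i) ∧ ∀ i, r (d i) (d (i + 1)) := by
  choose! next hnext using fun y (hy : ∃ x, r x y) => hy.elim fun x => extend x y
  let d : ℕ → α := Nat.rec (e 0) fun i x => if i ≤ n then e (i + 1) else next x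
  have d_succ (i : ℕ) : d (i + 1) = if i ≤ n then e (i + 1) else next (d i) := rfl
  have d_eq (i : ℕ) (hi : i ≤ n + 1) : d i = e i := by
    cases i with
    | zero => rfl
    | succ i => rw [d_succ, if_pos (by omega)]
  refine ⟨d, fun i hi => d_eq i (by omega), fun i => ?_⟩
  induction i with
  | zero => exact d_eq 0 (by omega) ▸ d_eq 1 (by omega) ▸ he 0 n.zero_le
  | succ i ih =>
    rcases le_or_gt (i + 1) n with hi | hi
    · rw [d_eq (i + 1) (by omega), d_eq (i + 1 + 1) (by omega)]
      exact he (i + 1) hi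
    · rw [d_succ (i + 1), if_neg (by omega)]
      exact hnext _ ⟨_, ih⟩

/-! ### The reduction -/

/-- The facts that describe an initial segment of a chain, up to `n + 1`. -/
def chainFacts (n : ℕ) : List (Atom ℕ ℕ) :=
  constAtom zeroP [0] ::
    ((List.range (n + 1)).map (fun i => constAtom nextP [i, i + 1]) ++
      (List.range (n + 1)).map fun i => constAtom transP [i + 1, i])

/-- The instance that asks whether `eval c n` is defined. Its rules do not depend on `n`. -/
def evalInstance (c : Code) (n : ℕ) : Instance :=
  (chainFacts n, transRule :: extendRule :: evalRules c, (evalP c, [Sum.inl n, Sum.inr 0]))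

theorem forall_mem_chainFacts {n : ℕ} {p : Atom ℕ ℕ → Prop} :
    (∀ a ∈ chainFacts n, p a) ↔ p (constAtom zeroP [0]) ∧
      (∀ i ≤ n, p (constAtom nextP [i, i + 1])) ∧ ∀ i ≤ n, p (constAtom transP [i + 1, i]) := by
  simp only [chainFacts, List.forall_mem_cons, List.forall_mem_append, List.forall_mem_map,
    List.mem_range, Nat.lt_succ_iff]

theorem satCQ_evalInstance_iff {D : Type} {I : Interp ℕ ℕ D} {c : Code} {n : ℕ} :
    I.SatCQ [(evalInstance c n).2.2] ↔ ∃ y, I.rel (evalP c) [I.const n, y] := by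
  simp only [Interp.SatCQ, Interp.satConj_cons, Interp.satConj_nil, and_true]
  exact ⟨fun ⟨v, hv⟩ => ⟨v 0, hv⟩, fun ⟨y, hy⟩ => ⟨fun _ => y, hy⟩⟩

theorem overMSAPlusTrans_evalInstance (c : Code) (n : ℕ) :
    (evalInstance c n).OverMSAPlusTrans := by
  refine ⟨forall_mem_chainFacts.2 (by simp [isFact_constAtom]), ?_,
    {r | r ∈ extendRule :: evalRules c}, {transRule}, ?_, ?_, ?_⟩
  · refine List.forall_mem_cons.2 ⟨by simp [transRule],
      List.forall_mem_cons.2 ⟨by simp [extendRule], fun r hr => ?_⟩⟩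
    have hr := isDerivationRule_of_mem_evalRules c r hr
    exact ⟨hr.body_ne_nil, hr.head_ne_nil⟩
  · ext r
    simp [evalInstance]
  · exact isMSA_of_forall_isDerivationRule fun r hr =>
      (List.mem_cons.1 hr).imp_right (isDerivationRule_of_mem_evalRules c r)
  · rintro r rfl
    exact ⟨transP, 0, 1, 2, by decide, by decide, by decide, rfl⟩

theorem dom_of_entailed {c : Code} {n : ℕ} (h : (evalInstance c n).Entailed) :
    (eval c n).Dom := by
  have facts : ∀ a ∈ chainFacts n, natModel.SatCQ [a] :=
    by
    simp only [forall_mem_chainFacts, Interp.satCQ_constAtom, List.map, natModel_next,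
      natModel_trans, natModel_zero]
    simp [natModel]
  have rules : ∀ r ∈ transRule :: extendRule :: evalRules c, natModel.SatRule r :=
    List.forall_mem_cons.2 ⟨natModel_transRule,
      List.forall_mem_cons.2 ⟨natModel_extendRule, natModel_evalRules c⟩⟩
  obtain ⟨y, hy⟩ := satCQ_evalInstance_iff.1 (h ℕ natModel facts rules)
  exact Part.dom_iff_mem.2 ⟨y, (natModel_eval n y c).1 hy⟩

theorem entailed_of_dom {c : Code} {n : ℕ} (h : (eval c n).Dom) :
    (evalInstance c n).Entailed := by
  intro D I facts rules
  have : Nonempty D := ⟨I.const 0⟩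
  obtain ⟨zero, next, back⟩ := forall_mem_chainFacts.1 facts
  simp only [Interp.satCQ_constAtom, List.map] at zero next back
  obtain ⟨trans, rules⟩ := List.forall_mem_cons.1 rules
  obtain ⟨extend, evalRules⟩ := List.forall_mem_cons.1 rules
  obtain ⟨d, d_eq, hd⟩ := exists_seq_prolonging
    (r := fun x y => I.rel nextP [x, y] ∧ I.rel transP [y, x])
    (fun _ _ ⟨next, back⟩ => exists_next_of_extendRule extend trans next back)
    I.const n fun i hi => ⟨next i hi, back i hi⟩
  have numbering : IsNumbering I d := ⟨fun i => (hd i).1, by rwa [d_eq 0 n.zero_le]⟩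
  obtain ⟨y, hy⟩ := Part.dom_iff_mem.1 h
  exact satCQ_evalInstance_iff.2
    ⟨d y, d_eq n le_rfl ▸ numbering.representsEval evalRules n y hy⟩

theorem entailed_evalInstance_iff {c : Code} {n : ℕ} :
    (evalInstance c n).Entailed ↔ (eval c n).Dom :=
  ⟨dom_of_entailed, entailed_of_dom⟩

/-! ### Undecidability -/

theorem primrec_constAtom_pair (p : ℕ) {f g : ℕ → ℕ} (hf : Primrec f) (hg : Primrec g) :
    Primrec fun i => (constAtom p [f i, g i] : Atom ℕ ℕ) :=
  (Primrec.const p).pair <| Primrec.list_cons.comp (Primrec.sumInl.comp hf) <|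
    Primrec.list_cons.comp (Primrec.sumInl.comp hg) (Primrec.const [])

theorem primrec_chainFacts : Primrec chainFacts := by
  have range : Primrec fun n : ℕ => List.range (n + 1) := Primrec.list_range.comp Primrec.succ
  have next := primrec_constAtom_pair nextP Primrec.id Primrec.succ
  have back := primrec_constAtom_pair transP Primrec.succ Primrec.id
  exact Primrec.list_cons.comp (Primrec.const _) <| Primrec.list_append.comp
    (Primrec.list_map range (next.comp Primrec.snd).to₂)
    (Primrec.list_map range (back.comp Primrec.snd).to₂)

theorem primrec_evalInstance (c : Code) : Primrec (evalInstance c) :=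
  primrec_chainFacts.pair <| (Primrec.const _).pair <| (Primrec.const _).pair <|
    Primrec.list_cons.comp Primrec.sumInl (Primrec.const _)

theorem exists_code_not_computablePred_dom :
    ∃ c : Code, ¬ ComputablePred fun n => (eval c n).Dom := by
  have universal : Partrec fun n : ℕ => eval (ofNat Code n) 0 :=
    Nat.Partrec.Code.eval_part.comp (Computable.ofNat Code) (Computable.const 0)
  obtain ⟨c, hc⟩ := exists_code.1 (Partrec.nat_iff.1 universal)
  refine ⟨c, fun h => ComputablePred.halting_problem 0 ?_⟩
  refine ComputablePred.computable_of_manyOneReducible ⟨encode, Computable.encode, fun c' => ?_⟩ h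
  have eval_encode : eval c (encode c') = eval c' 0 := by
    simpa only [Denumerable.ofNat_encode] using congrFun hc (encode c')
  rw [eval_encode]

theorem DecidableOn.computablePred_comp {α β : Type} [Primcodable α] [Primcodable β]
    {dom p : β → Prop} (h : DecidableOn dom p) {g : α → β} (hg : Computable g)
    (hdom : ∀ a, dom (g a)) : ComputablePred fun a => p (g a) := by
  obtain ⟨f, hf, hfp⟩ := h
  choose b hb hbp using fun a => hfp (g a) (hdom a)
  have computable_b : Computable b := (hf.comp hg).of_eq fun a => Part.eq_some_iff.2 (hb a)
  exact ComputablePred.computable_iff.2 ⟨b, computable_b, funext fun a => propext (hbp a).symm⟩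

end ExRules

theorem mainTheorem6 :
    ¬ ExRules.DecidableOn ExRules.Instance.OverMSAPlusTrans ExRules.Instance.Entailed := by
  intro decidable
  obtain ⟨c, not_computable⟩ := ExRules.exists_code_not_computablePred_dom
  have computable := decidable.computablePred_comp (ExRules.primrec_evalInstance c).to_comp
    (ExRules.overMSAPlusTrans_evalInstance c)
  exact not_computable (computable.of_eq fun n => ExRules.entailed_evalInstance_iff)
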